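/- Let $\mathcal M\subset\mathbb R^n$ be an embedded $C^k$ submanifold of codimension $c$ (near each of its points, $\mathcal M$ is the zero set of a $C^k$ map to $\mathbb R^c$ that has $0$ as a regular value), with the Riemannian metric induced by $\mathbb R^n$ and the Riemannian distance $d_g$ (the infimum of the lengths of $C^1$ curves in $\mathcal M$, $\infty$ if there are none). For $x\in\mathcal M$ and $v\in T_x\mathcal M$ let $\exp(x,v)=\gamma_v(1)$, where $\gamma_v$ is the geodesic of $\mathcal M$ (a $C^2$ curve in $\mathcal M$ whose acceleration in $\mathbb R^n$ has zero tangential part) with $\gamma_v(0)=x$, $\gamma_v'(0)=v$, and let $R_P(x,v)=\arg\min\{\|y-(x+v)\| : y\in\mathcal M\}$ be the projective retraction. (1) If $k\ge 3$ ($k=\infty$ and real-analytic allowed), then for all $x\in\mathcal M$ and $v\in T_x\mathcal M$ the points $R_P(x,tv)$ and $\exp(x,tv)$ exist and are unique for all $t\in\mathbb R$ close enough to $0$, and $R_P(x,tv)=\exp(x,tv)+o(t^2)$, in the sense that $$\lim_{t\to 0}\frac{d_g\bigl(R_P(x,tv),\exp(x,tv)\bigr)}{t^2}=0 .$$ (2)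 The order in (1) is sharp: the unit circle $\mathbb S^1\subset\mathbb R^2$ is a $C^k$ submanifold of codimension $1$ for every $k\ge 4$, and there are $x\in\mathbb S^1$ and $v\in T_x\mathbb S^1$ for which it is not true that $$\lim_{t\to 0}\frac{d_g\bigl(R_P(x,tv),\exp(x,tv)\bigr)}{|t|^3}=0 .$$ -/

import Mathlib

open Set Filter Topology

namespace Submfd

noncomputable section

/-- `M` is an (embedded) `C^k` submanifold of `ℝⁿ` of codimension `c`: near each of its points it is
the zero set of a `C^k` map to `ℝᶜ` for which `0` is a regular value. -/
def IsSubmanifold {n : ℕ} (k : WithTop ℕ∞) (c : ℕ) (M : Set (EuclideanSpace ℝ (Fin n))) : Prop :=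
  ∀ x ∈ M, ∃ (U : Set (EuclideanSpace ℝ (Fin n)))
    (F : EuclideanSpace ℝ (Fin n) → EuclideanSpace ℝ (Fin c)),
    IsOpen U ∧ x ∈ U ∧ ContDiffOn ℝ k F U ∧ M ∩ U = {y ∈ U | F y = 0} ∧
      ∀ y ∈ M ∩ U, Function.Surjective (fderiv ℝ F y)

/-- The tangent space `T_x M`, made of the velocities at `x` of curves in `M`. (For a submanifold
these velocities already form a linear subspace, so that taking the span adds nothing.) -/
def tangentSpace {n : ℕ} (M : Set (EuclideanSpace ℝ (Fin n))) (x : EuclideanSpace ℝ (Fin n)) :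
    Submodule ℝ (EuclideanSpace ℝ (Fin n)) :=
  Submodule.span ℝ {v | ∃ γ : ℝ → EuclideanSpace ℝ (Fin n),
    γ 0 = x ∧ (∀ᶠ t in 𝓝 0, γ t ∈ M) ∧ HasDerivAt γ v 0}

/-- The intrinsic acceleration `D_t γ'` of a curve in `M`, for the Levi-Civita connection of the
metric induced on `M` by `ℝⁿ`: the tangential part of the acceleration in `ℝⁿ`. -/
def intrinsicAcceleration {n : ℕ} (M : Set (EuclideanSpace ℝ (Fin n)))
    (γ : ℝ → EuclideanSpace ℝ (Fin n)) (t : ℝ) : EuclideanSpace ℝ (Fin n) :=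
  (tangentSpace M (γ t)).starProjection (deriv (deriv γ) t)

/-- `γ` restricts to a geodesic of `M` on the open interval `I`. -/
def IsGeodesicOn {n : ℕ} (M : Set (EuclideanSpace ℝ (Fin n)))
    (γ : ℝ → EuclideanSpace ℝ (Fin n)) (I : Set ℝ) : Prop :=
  ContDiffOn ℝ 2 γ I ∧ (∀ t ∈ I, γ t ∈ M) ∧ ∀ t ∈ I, intrinsicAcceleration M γ t = 0

/-- `y = γ 1` for a geodesic `γ` of `M` that starts at `x` with velocity `v` and exists on an open
interval around `[0, 1]`. -/
def IsExpValue {n : ℕ} (M : Set (EuclideanSpace ℝ (Fin n)))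
    (x v y : EuclideanSpace ℝ (Fin n)) : Prop :=
  ∃ (γ : ℝ → EuclideanSpace ℝ (Fin n)) (ε : ℝ), 0 < ε ∧ IsGeodesicOn M γ (Ioo (-ε) (1 + ε)) ∧
    γ 0 = x ∧ deriv γ 0 = v ∧ γ 1 = y

/-- The tangent vectors at which the exponential map has exactly one value. -/
def expDomain {n : ℕ} (M : Set (EuclideanSpace ℝ (Fin n))) :
    Set (EuclideanSpace ℝ (Fin n) × EuclideanSpace ℝ (Fin n)) :=
  {p | p.1 ∈ M ∧ p.2 ∈ tangentSpace M p.1 ∧ ∃! y, IsExpValue M p.1 p.2 y}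

/-- The exponential map `exp (x, v) = γ_v 1`; meaningful on `expDomain M`. -/
def expMap {n : ℕ} (M : Set (EuclideanSpace ℝ (Fin n))) (x v : EuclideanSpace ℝ (Fin n)) :
    EuclideanSpace ℝ (Fin n) :=
  Classical.epsilon (IsExpValue M x v)

/-- The set `argmin {‖y - z‖ : y ∈ M}`. -/
def nearestPoints {n : ℕ} (M : Set (EuclideanSpace ℝ (Fin n))) (z : EuclideanSpace ℝ (Fin n)) :
    Set (EuclideanSpace ℝ (Fin n)) :=
  {y | y ∈ M ∧ ∀ w ∈ M, ‖y - z‖ ≤ ‖w - z‖}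

/-- The tangent vectors `(x, v)` for which `x + v` has exactly one nearest point in `M`. -/
def projDomain {n : ℕ} (M : Set (EuclideanSpace ℝ (Fin n))) :
    Set (EuclideanSpace ℝ (Fin n) × EuclideanSpace ℝ (Fin n)) :=
  {p | p.1 ∈ M ∧ p.2 ∈ tangentSpace M p.1 ∧ ∃! y, y ∈ nearestPoints M (p.1 + p.2)}

/-- The projective retraction `R_P (x, v) = P_M (x + v)`; meaningful on `projDomain M`. -/
def projRetraction {n : ℕ} (M : Set (EuclideanSpace ℝ (Fin n))) (x v : EuclideanSpace ℝ (Fin n)) :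
    EuclideanSpace ℝ (Fin n) :=
  Classical.epsilon fun y => y ∈ nearestPoints M (x + v)

/-- The Riemannian distance of `M` for the metric induced by `ℝⁿ`: the infimum of the lengths of
the `C^1` curves in `M` from `x` to `y` (`∞` if there are none). -/
def riemannianDist {n : ℕ} (M : Set (EuclideanSpace ℝ (Fin n)))
    (x y : EuclideanSpace ℝ (Fin n)) : ENNReal :=
  ⨅ (γ : ℝ → EuclideanSpace ℝ (Fin n)) (_ : ContDiffOn ℝ 1 γ (Icc 0 1) ∧
    (∀ t ∈ Icc (0 : ℝ) 1, γ t ∈ M) ∧ γ 0 = x ∧ γ 1 = y),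
    ∫⁻ t in Icc (0 : ℝ) 1, ‖derivWithin γ (Icc 0 1) t‖ₑ

/-- `R_P (x, t v) = exp (x, t v) + o(t^i)` in Riemannian distance, for the given `(x, v)`. -/
def ProjAgreesWithExp {n : ℕ} (M : Set (EuclideanSpace ℝ (Fin n))) (i : ℕ)
    (x v : EuclideanSpace ℝ (Fin n)) : Prop :=
  Tendsto (fun t : ℝ =>
      riemannianDist M (projRetraction M x (t • v)) (expMap M x (t • v)) / ‖t‖ₑ ^ i)
    (𝓝[≠] 0) (𝓝 0)

end

end Submfd

/-! Let `γ` be the geodesic with initial velocity `v`, `z = x + t v`, `p` a nearest point to `z`,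
and `d = γ t - p`. The acceleration `a` of `γ` at `0` is normal at `x`, and Taylor gives `γ t - z =
(t²/2) a + e` with `e = o(t²)`. Hence `‖d‖² = (t²/2)⟪a, d⟫ + ⟪e, d⟫ + ⟪z - p, d⟫`. Since `F`
vanishes at `γ t` and `p`, strict differentiability makes `d` almost tangent at `x`, so `⟪a, d⟫ =
o(‖d‖)`. By minimality `z - p` is normal at `p`, while secants leave the tangent space
quadratically, so the last term is at most `‖d‖²/2`. Thus `‖d‖ = o(t²)`; no smoothness of the
projection is needed. This is `isLittleO_sub_nearestPoint`, and `exists_riemannianDist_le` transfers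
it to the Riemannian distance.

The secant bound `exists_abs_inner_secant_le` also makes nearest points unique, and compactness
makes them exist. Geodesics come from an ODE in the ambient space, with normal part of the
acceleration supplied by `normalLift`.

For sharpness, on the sphere both points are explicit, and their distance in the ambient space, a
lower bound for the Riemannian one, is of order `t³`. -/

namespace Submfd

/-! ### Normal right inverses of surjective operators -/

section NormalLift

variable {E G : Type*} [NormedAddCommGroup E] [InnerProductSpace ℝ E] [CompleteSpace E]
  [NormedAddCommGroup G] [InnerProductSpace ℝ G] [CompleteSpace G]

theorem contDiff_adjoint {k : WithTop ℕ∞} :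
    ContDiff ℝ k (fun A : E →L[ℝ] G => ContinuousLinearMap.adjoint A) := by
  have h : IsBoundedLinearMap ℝ (fun A : E →L[ℝ] G => ContinuousLinearMap.adjoint A) :=
    { map_add := fun A B => map_add _ A B
      map_smul := fun c A => by simp
      bound := ⟨1, one_pos, fun A => by simp⟩ }
  exact h.contDiff

/-- The right inverse `A† (A A†)⁻¹` of a surjective `A`, with values orthogonal to `ker A`. -/
noncomputable def normalLift (A : E →L[ℝ] G) : G →L[ℝ] E :=
  (ContinuousLinearMap.adjoint A).comp
    (ContinuousLinearMap.inverse (A.comp (ContinuousLinearMap.adjoint A)))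

theorem inner_normalLift (A : E →L[ℝ] G) (g : G) {w : E} (hw : A w = 0) :
    inner ℝ (normalLift A g) w = 0 := by
  simp [normalLift, ContinuousLinearMap.adjoint_inner_left, hw]

variable [FiniteDimensional ℝ G]

theorem exists_equiv_comp_adjoint {A : E →L[ℝ] G} (hA : Function.Surjective A) :
    ∃ e : G ≃L[ℝ] G, (e : G →L[ℝ] G) = A.comp (ContinuousLinearMap.adjoint A) := by
  have hinj : Function.Injective (A.comp (ContinuousLinearMap.adjoint A) : G →ₗ[ℝ] G) := by
    rw [← LinearMap.ker_eq_bot, LinearMap.ker_eq_bot']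
    intro g hg
    have hg' : A (ContinuousLinearMap.adjoint A g) = 0 := hg
    have h0 : ContinuousLinearMap.adjoint A g = 0 := by
      rw [← inner_self_eq_zero (𝕜 := ℝ), ContinuousLinearMap.adjoint_inner_left, hg', inner_zero_right]
    obtain ⟨e, rfl⟩ := hA g
    rw [← inner_self_eq_zero (𝕜 := ℝ), ← ContinuousLinearMap.adjoint_inner_left, h0, inner_zero_left]
  exact ⟨(LinearEquiv.ofInjectiveEndo _ hinj).toContinuousLinearEquiv, by ext g; rfl⟩

theorem apply_normalLift {A : E →L[ℝ] G} (hA : Function.Surjective A) (g : G) :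
    A (normalLift A g) = g := by
  obtain ⟨e, he⟩ := exists_equiv_comp_adjoint hA
  have : A (normalLift A g) = (A.comp (ContinuousLinearMap.adjoint A))
      (ContinuousLinearMap.inverse (A.comp (ContinuousLinearMap.adjoint A)) g) := rfl
  rw [this, ← he]
  simp

theorem contDiffAt_normalLift {k : WithTop ℕ∞} {A : E →L[ℝ] G} (hA : Function.Surjective A) :
    ContDiffAt ℝ k (normalLift (E := E) (G := G)) A := by
  obtain ⟨e, he⟩ := exists_equiv_comp_adjoint hA
  have h1 : ContDiffAt ℝ k (fun A : E →L[ℝ] G => A.comp (ContinuousLinearMap.adjoint A)) A :=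
    (contDiff_id.clm_comp contDiff_adjoint).contDiffAt
  have h2 : ContDiffAt ℝ k ContinuousLinearMap.inverse (A.comp (ContinuousLinearMap.adjoint A)) :=
    he ▸ contDiffAt_map_inverse e
  exact contDiff_adjoint.contDiffAt.clm_comp (ContDiffAt.comp (f := fun A : E →L[ℝ] G =>
    A.comp (ContinuousLinearMap.adjoint A)) A h2 h1)

/-- The difference of the two sides lies in `ker A` and is orthogonal to it. This determines a
normal vector, such as a geodesic's acceleration, from its image under `A`. -/
theorem eq_normalLift_of_orthogonal {A : E →L[ℝ] G} (hA : Function.Surjective A) {u : E}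
    (hu : ∀ w, A w = 0 → inner ℝ u w = 0) : u = normalLift A (A u) := by
  have hk : A (u - normalLift A (A u)) = 0 := by rw [map_sub, apply_normalLift hA, sub_self]
  rw [← sub_eq_zero, ← inner_self_eq_zero (𝕜 := ℝ), inner_sub_left, hu _ hk,
    inner_normalLift A _ hk, sub_zero]

/-- Invertibility of `B B†` is an open condition, and it forces `B` to be onto. -/
theorem eventually_surjective {A : E →L[ℝ] G} (hA : Function.Surjective A) :
    ∀ᶠ B : E →L[ℝ] G in 𝓝 A, Function.Surjective B := by
  obtain ⟨e, he⟩ := exists_equiv_comp_adjoint hA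
  have h1 : ContinuousAt (fun A : E →L[ℝ] G => A.comp (ContinuousLinearMap.adjoint A)) A :=
    (contDiff_id.clm_comp (contDiff_adjoint (k := 0))).continuous.continuousAt
  have h2 := h1.eventually (show ∀ᶠ C in 𝓝 (A.comp (ContinuousLinearMap.adjoint A)),
    C ∈ range ((↑) : (G ≃L[ℝ] G) → G →L[ℝ] G) from he ▸ e.nhds)
  filter_upwards [h2] with B ⟨e', he'⟩ g
  exact ⟨ContinuousLinearMap.adjoint B (e'.symm g), by
    have := DFunLike.congr_fun he' (e'.symm g)
    simpa using this.symm⟩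

/-- Modulo `ker A`, `d` equals `normalLift A (A d)`, and `u` does not see the kernel part. So a
small `A d` makes `d` nearly orthogonal to normal vectors. -/
theorem abs_inner_le_of_orthogonal {A : E →L[ℝ] G} (hA : Function.Surjective A) {u : E}
    (hu : ∀ w, A w = 0 → inner ℝ u w = 0) (d : E) :
    |inner ℝ u d| ≤ ‖u‖ * (‖normalLift A‖ * ‖A d‖) := by
  have hk : A (d - normalLift A (A d)) = 0 := by rw [map_sub, apply_normalLift hA, sub_self]
  have h := hu _ hk
  rw [inner_sub_right, sub_eq_zero] at h
  rw [h]
  exact (abs_real_inner_le_norm _ _).trans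
    (mul_le_mul_of_nonneg_left (ContinuousLinearMap.le_opNorm _ _) (norm_nonneg _))

end NormalLift

/-! ### Straightening a submersion -/

section Straightening

variable {E G : Type*} [NormedAddCommGroup E] [InnerProductSpace ℝ E] [CompleteSpace E]
  [NormedAddCommGroup G] [NormedSpace ℝ G] [CompleteSpace G]

/-- Near a point where its derivative is surjective, `F` is the first component of a local
`C¹` diffeomorphism. -/
theorem exists_straightening {F : E → G} {x : E} (hF : ContDiffAt ℝ 1 F x)
    (hs : Function.Surjective (fderiv ℝ F x)) :
    ∃ (P : E →L[ℝ] (fderiv ℝ F x).ker)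
      (Ψ : G × (fderiv ℝ F x).ker → E),
      ContDiffAt ℝ 1 Ψ (F x, P x) ∧ (∀ᶠ y in 𝓝 x, Ψ (F y, P y) = y) ∧
      (∀ᶠ z in 𝓝 (F x, P x), F (Ψ z) = z.1) := by
  set A := fderiv ℝ F x with hA
  set T := A.ker
  let P : E →L[ℝ] T := T.orthogonalProjectionOnto
  -- Pairing `A` with the orthogonal projection onto its kernel gives an isomorphism, so the inverse
  -- function theorem applies to `(F, P)`.
  let e : E ≃L[ℝ] G × T := A.equivProdOfSurjectiveOfIsCompl P (LinearMap.range_eq_top.2 hs)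
    (LinearMap.range_eq_top.2 fun y => ⟨y, by simp [P]⟩)
    (by
      have : (P : E →ₗ[ℝ] T).ker = Tᗮ := by ext y; simp [P]
      rw [this]; exact Submodule.isCompl_orthogonal (K := T))
  have hΦ : ContDiffAt ℝ 1 (fun y => (F y, P y)) x := hF.prodMk P.contDiff.contDiffAt
  have hΦ' : HasFDerivAt (fun y => (F y, P y)) (e : E →L[ℝ] G × T) x :=
    (hF.differentiableAt one_ne_zero).hasFDerivAt.prodMk P.hasFDerivAt
  refine ⟨P, hΦ.localInverse hΦ' one_ne_zero, hΦ.to_localInverse hΦ' one_ne_zero,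
    (hΦ.hasStrictFDerivAt' hΦ' one_ne_zero).eventually_left_inverse, ?_⟩
  filter_upwards [(hΦ.hasStrictFDerivAt' hΦ' one_ne_zero).eventually_right_inverse] with z hz
  exact congrArg Prod.fst hz

end Straightening

/-- `F` is a `C³` submersion on `U` and cuts `M` out of `U`. -/
structure IsLocalDefining {n c : ℕ} (M U : Set (EuclideanSpace ℝ (Fin n)))
    (F : EuclideanSpace ℝ (Fin n) → EuclideanSpace ℝ (Fin c)) : Prop where
  isOpen : IsOpen U
  contDiffOn : ContDiffOn ℝ 3 F U
  mem_iff : ∀ y ∈ U, y ∈ M ↔ F y = 0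
  surjective : ∀ y ∈ U, Function.Surjective (fderiv ℝ F y)

/-- Surjectivity is given only on `M`, but it is open, so shrinking `U` extends it to all of `U`. -/
theorem IsSubmanifold.exists_isLocalDefining {n c : ℕ} {k : WithTop ℕ∞} (hk : 3 ≤ k)
    {M : Set (EuclideanSpace ℝ (Fin n))} (hM : IsSubmanifold k c M) {x : EuclideanSpace ℝ (Fin n)}
    (hx : x ∈ M) : ∃ (U : Set (EuclideanSpace ℝ (Fin n)))
      (F : EuclideanSpace ℝ (Fin n) → EuclideanSpace ℝ (Fin c)), x ∈ U ∧ IsLocalDefining M U F := by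
  obtain ⟨U, F, hU, hxU, hF, hMU, hs⟩ := hM x hx
  have hF3 : ContDiffOn ℝ 3 F U := hF.of_le hk
  have hd : ContinuousAt (fderiv ℝ F) x :=
    (hF3.contDiffAt (hU.mem_nhds hxU)).continuousAt_fderiv (by norm_num)
  obtain ⟨V, hV, hVo, hxV⟩ := eventually_nhds_iff.1
    (hd.eventually (eventually_surjective (hs x ⟨hx, hxU⟩)))
  refine ⟨U ∩ V, F, ⟨hxU, hxV⟩, hU.inter hVo, hF3.mono inter_subset_left, fun y hy => ?_,
    fun y hy => hV y hy.2⟩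
  have := Set.ext_iff.1 hMU y
  simp only [mem_inter_iff, hy.1, and_true, mem_ofPred_eq, true_and] at this
  exact this

/-! ### Tangent space and Riemannian distance via a local defining map -/

namespace IsLocalDefining

variable {n c : ℕ} {M U : Set (EuclideanSpace ℝ (Fin n))}
  {F : EuclideanSpace ℝ (Fin n) → EuclideanSpace ℝ (Fin c)} {x : EuclideanSpace ℝ (Fin n)}

theorem contDiffAt (h : IsLocalDefining M U F) (hx : x ∈ U) : ContDiffAt ℝ 3 F x :=
  h.contDiffOn.contDiffAt (h.isOpen.mem_nhds hx)

theorem hasFDerivAt (h : IsLocalDefining M U F) (hx : x ∈ U) : HasFDerivAt F (fderiv ℝ F x) x :=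
  ((h.contDiffAt hx).differentiableAt (by norm_num)).hasFDerivAt

theorem mem_tangentSpace_iff (h : IsLocalDefining M U F) (hx : x ∈ U) (hxM : x ∈ M)
    {w : EuclideanSpace ℝ (Fin n)} : w ∈ tangentSpace M x ↔ fderiv ℝ F x w = 0 := by
  constructor
  · intro hw
    have hle : tangentSpace M x ≤ (fderiv ℝ F x).ker := by
      refine Submodule.span_le.2 ?_
      rintro v ⟨γ, h0, hγM, hγ⟩
      have hU : ∀ᶠ t in 𝓝 (0 : ℝ), γ t ∈ U :=
        hγ.continuousAt.eventually (h0 ▸ h.isOpen.mem_nhds hx)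
      have h1 : HasDerivAt (F ∘ γ) (fderiv ℝ F x v) 0 :=
        HasFDerivAt.comp_hasDerivAt_of_eq 0 (h.hasFDerivAt hx) hγ h0.symm
      have h2 : F ∘ γ =ᶠ[𝓝 0] fun _ => 0 := by
        filter_upwards [hU, hγM] with t htU htM using (h.mem_iff _ htU).1 htM
      exact (h1.congr_of_eventuallyEq h2.symm).unique (hasDerivAt_const _ _)
    exact hle hw
  · intro hw
    obtain ⟨P, Ψ, hΨ, hl, hr⟩ := exists_straightening ((h.contDiffAt hx).of_le (by norm_num))
      (h.surjective x hx)
    -- The curve is a straight line inside the slice with first coordinate `F x = 0`, so it stays in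
    -- `M`.
    refine Submodule.subset_span ⟨fun t => Ψ ((F x, P x) + t • ((0 : EuclideanSpace ℝ (Fin c)), P w)),
      by simpa using hl.self_of_nhds, ?_, ?_⟩
    · have hc : ContinuousAt (fun t : ℝ => (F x, P x) + t • ((0 : EuclideanSpace ℝ (Fin c)), P w)) 0 := by
        fun_prop
      have hc' : Tendsto (fun t : ℝ => (F x, P x) + t • ((0 : EuclideanSpace ℝ (Fin c)), P w)) (𝓝 0)
        (𝓝 (F x, P x)) := by simpa [ContinuousAt] using hc
      have hΨc : Tendsto Ψ (𝓝 (F x, P x)) (𝓝 x) := by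
        have := hΨ.continuousAt
        rwa [ContinuousAt, hl.self_of_nhds] at this
      filter_upwards [hc'.eventually hr, (hΨc.comp hc').eventually (h.isOpen.mem_nhds hx)] with t h1 h2
      refine (h.mem_iff _ h2).2 ?_
      rw [Function.comp_apply, h1]
      simp [(h.mem_iff x hx).1 hxM]
    · have hΨ' : HasFDerivAt Ψ (fderiv ℝ Ψ (F x, P x)) (F x, P x) :=
        (hΨ.differentiableAt one_ne_zero).hasFDerivAt
      have h1 : HasFDerivAt (fun y => Ψ (F y, P y)) ((fderiv ℝ Ψ (F x, P x)).comp
          ((fderiv ℝ F x).prod P)) x :=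
        HasFDerivAt.comp (g := Ψ) (f := fun y => (F y, P y)) x hΨ'
          ((h.hasFDerivAt hx).prodMk P.hasFDerivAt)
      have h2 := (h1.congr_of_eventuallyEq (f₁ := id)
        (hl.mono fun y hy => hy.symm)).unique (hasFDerivAt_id x)
      have h3 : fderiv ℝ Ψ (F x, P x) (0, P w) = w := by
        have := DFunLike.congr_fun h2 w
        simpa [hw] using this
      have h4 : HasDerivAt (fun t : ℝ => (F x, P x) + t • ((0 : EuclideanSpace ℝ (Fin c)), P w))
          ((0 : EuclideanSpace ℝ (Fin c)), P w) 0 := by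
        simpa using ((hasDerivAt_id (0 : ℝ)).smul_const
          ((0 : EuclideanSpace ℝ (Fin c)), P w)).const_add (F x, P x)
      have h5 := HasFDerivAt.comp_hasDerivAt_of_eq 0 hΨ' h4 (by simp)
      rwa [h3] at h5

/-- In straightened coordinates `M` is a flat slice. The image of a segment in it is a curve in `M`
whose speed is controlled by the Lipschitz constant of `Ψ`. -/
theorem exists_riemannianDist_le (h : IsLocalDefining M U F) (hx : x ∈ U) :
    ∃ C : NNReal, ∀ᶠ z in 𝓝 (x, x), z.1 ∈ M → z.2 ∈ M →
      riemannianDist M z.1 z.2 ≤ C * ‖z.2 - z.1‖ₑ := by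
  obtain ⟨P, Ψ, hΨ, hl, hr⟩ := exists_straightening ((h.contDiffAt hx).of_le (by norm_num))
    (h.surjective x hx)
  obtain ⟨K, s, hs, hK⟩ := hΨ.exists_lipschitzOnWith
  have hΨU : ∀ᶠ z in 𝓝 (F x, P x), Ψ z ∈ U := by
    have := hΨ.continuousAt
    rw [ContinuousAt, hl.self_of_nhds] at this
    exact this.eventually (h.isOpen.mem_nhds hx)
  obtain ⟨r, hr0, hball⟩ := Metric.eventually_nhds_iff_ball.1
    ((hΨ.eventually (by simp)).and ((eventually_mem_nhds_iff.2 hs).and (hr.and hΨU)))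
  have hev : ∀ᶠ y in 𝓝 x, y ∈ U ∧ Ψ (F y, P y) = y ∧ (F y, P y) ∈ Metric.ball (F x, P x) r := by
    have hc : ContinuousAt (fun y => (F y, P y)) x :=
      (h.hasFDerivAt hx).continuousAt.prodMk P.continuous.continuousAt
    exact (h.isOpen.eventually_mem hx).and
      (hl.and (hc.eventually (Metric.ball_mem_nhds _ hr0)))
  refine ⟨K * ‖P‖₊, ?_⟩
  filter_upwards [continuous_fst.continuousAt.eventually hev,
    continuous_snd.continuousAt.eventually hev]
  rintro ⟨p, q⟩ ⟨hpU, hp, hpb⟩ ⟨hqU, hq, hqb⟩ hpM hqM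
  simp only at *
  rw [(h.mem_iff p hpU).1 hpM] at hp hpb
  rw [(h.mem_iff q hqU).1 hqM] at hq hqb
  set a : EuclideanSpace ℝ (Fin c) × (fderiv ℝ F x).ker := (0, P p)
  set b : EuclideanSpace ℝ (Fin c) × (fderiv ℝ F x).ker := (0, P q)
  have hline : ∀ t ∈ Icc (0 : ℝ) 1, AffineMap.lineMap a b t ∈ Metric.ball (F x, P x) r :=
    fun t ht => (convex_ball _ _).lineMap_mem hpb hqb ht
  have hnorm : ‖b - a‖ ≤ ‖P‖ * ‖q - p‖ := by
    have : b - a = (0, P (q - p)) := by simp [a, b]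
    rw [this, Prod.norm_def]
    simpa using P.le_opNorm (q - p)
  have hder : ∀ t ∈ Icc (0 : ℝ) 1, HasDerivAt (fun t : ℝ => Ψ (AffineMap.lineMap a b t))
      (fderiv ℝ Ψ (AffineMap.lineMap a b t) (b - a)) t := fun t ht =>
    HasFDerivAt.comp_hasDerivAt (f := fun t : ℝ => AffineMap.lineMap a b t) t
      (((hball _ (hline t ht)).1.differentiableAt one_ne_zero).hasFDerivAt) AffineMap.hasDerivAt_lineMap
  have hmem : ContDiffOn ℝ 1 (fun t : ℝ => Ψ (AffineMap.lineMap a b t)) (Icc 0 1) ∧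
      (∀ t ∈ Icc (0 : ℝ) 1, Ψ (AffineMap.lineMap a b t) ∈ M) ∧
      Ψ (AffineMap.lineMap a b (0 : ℝ)) = p ∧ Ψ (AffineMap.lineMap a b (1 : ℝ)) = q := by
    refine ⟨fun t ht => ?_, fun t ht => ?_, by simpa using hp, by simpa using hq⟩
    · exact ((hball _ (hline t ht)).1.comp t
        (AffineMap.contDiff_lineMap a b).contDiffAt).contDiffWithinAt
    · obtain ⟨-, -, h1, h2⟩ := hball _ (hline t ht)
      rw [h.mem_iff _ h2, h1]
      simp [AffineMap.lineMap_apply, a, b]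
  refine iInf_le_of_le (fun t : ℝ => Ψ (AffineMap.lineMap a b t)) (iInf_le_of_le hmem ?_)
  have hb : ∀ t ∈ Icc (0 : ℝ) 1, ‖derivWithin (fun t : ℝ => Ψ (AffineMap.lineMap a b t)) (Icc 0 1) t‖ₑ ≤
      ((K * ‖P‖₊ : NNReal) : ENNReal) * ‖q - p‖ₑ := by
    intro t ht
    rw [((hder t ht).hasDerivWithinAt).derivWithin (uniqueDiffOn_Icc one_pos t ht)]
    have h1 : ‖fderiv ℝ Ψ (AffineMap.lineMap a b t)‖ ≤ K :=
      norm_fderiv_le_of_lipschitzOn ℝ (hball _ (hline t ht)).2.1 hK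
    have h2 : ‖fderiv ℝ Ψ (AffineMap.lineMap a b t) (b - a)‖ ≤ K * ‖P‖ * ‖q - p‖ := by
      refine (ContinuousLinearMap.le_of_opNorm_le _ h1 _).trans ?_
      rw [mul_assoc]
      exact mul_le_mul_of_nonneg_left hnorm K.2
    have h3 : ‖fderiv ℝ Ψ (AffineMap.lineMap a b t) (b - a)‖₊ ≤ K * ‖P‖₊ * ‖q - p‖₊ := h2
    rw [enorm_eq_nnnorm, enorm_eq_nnnorm]
    exact_mod_cast h3
  refine (MeasureTheory.setLIntegral_mono' measurableSet_Icc hb).trans ?_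
  simp

end IsLocalDefining

/-! ### Geodesics and the exponential map -/

section Geodesic

variable {n : ℕ} {M : Set (EuclideanSpace ℝ (Fin n))} {γ : ℝ → EuclideanSpace ℝ (Fin n)}
  {I : Set ℝ} {t : ℝ}

theorem starProjection_eq_zero_iff {E : Type*} [NormedAddCommGroup E] [InnerProductSpace ℝ E]
    {K : Submodule ℝ E} [K.HasOrthogonalProjection] {u : E} :
    K.starProjection u = 0 ↔ ∀ w ∈ K, inner ℝ u w = 0 := by
  rw [← Submodule.mem_orthogonal' K u, ← Submodule.ker_starProjection K]
  rfl

theorem IsGeodesicOn.hasDerivAt (hγ : IsGeodesicOn M γ I) (hI : IsOpen I) (ht : t ∈ I) :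
    HasDerivAt γ (deriv γ t) t :=
  ((hγ.1.contDiffAt (hI.mem_nhds ht)).differentiableAt (by norm_num)).hasDerivAt

theorem IsGeodesicOn.hasDerivAt_deriv (hγ : IsGeodesicOn M γ I) (hI : IsOpen I) (ht : t ∈ I) :
    HasDerivAt (deriv γ) (deriv (deriv γ) t) t := by
  have h : ContDiffAt ℝ 1 (deriv γ) t :=
    (hγ.1.contDiffAt (hI.mem_nhds ht)).derivWithin (by norm_num)
  exact (h.differentiableAt one_ne_zero).hasDerivAt

theorem IsGeodesicOn.deriv_mem_tangentSpace (hγ : IsGeodesicOn M γ I) (hI : IsOpen I)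
    (ht : t ∈ I) : deriv γ t ∈ tangentSpace M (γ t) := by
  refine Submodule.subset_span ⟨fun s => γ (t + s), by simp, ?_, ?_⟩
  · have hc : Tendsto (fun s => t + s) (𝓝 0) (𝓝 t) := by
      simpa using (continuous_const_add t).tendsto 0
    exact (hc.eventually (hI.mem_nhds ht)).mono fun s hs => hγ.2.1 _ hs
  · have h : HasDerivAt γ (deriv γ t) (t + 0) := by simpa using hγ.hasDerivAt hI ht
    exact h.comp_const_add t 0

theorem IsGeodesicOn.inner_deriv_deriv (hγ : IsGeodesicOn M γ I) (ht : t ∈ I)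
    {w : EuclideanSpace ℝ (Fin n)} (hw : w ∈ tangentSpace M (γ t)) :
    inner ℝ (deriv (deriv γ) t) w = 0 :=
  starProjection_eq_zero_iff.1 (hγ.2.2 t ht) w hw

/-- The acceleration is normal and the velocity tangent, so the squared speed has zero derivative.
-/
theorem IsGeodesicOn.norm_deriv_eq (hγ : IsGeodesicOn M γ I) (hI : IsOpen I)
    (hI' : IsPreconnected I) {s : ℝ} (hs : s ∈ I) (ht : t ∈ I) : ‖deriv γ t‖ = ‖deriv γ s‖ := by
  have hd : ∀ t ∈ I, HasDerivAt (fun t => ‖deriv γ t‖ ^ 2) 0 t := by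
    intro t ht
    have h := (hγ.hasDerivAt_deriv hI ht).norm_sq
    rwa [real_inner_comm, hγ.inner_deriv_deriv ht (hγ.deriv_mem_tangentSpace hI ht), mul_zero] at h
  have h := hI.is_const_of_deriv_eq_zero hI' (fun t ht => (hd t ht).differentiableAt.differentiableWithinAt)
    (fun t ht => (hd t ht).deriv) ht hs
  exact (sq_eq_sq₀ (norm_nonneg _) (norm_nonneg _)).1 h

theorem IsGeodesicOn.isExpValue {δ : ℝ} {x v : EuclideanSpace ℝ (Fin n)}
    (hγ : IsGeodesicOn M γ (Ioo (-δ) δ)) (h0 : γ 0 = x) (hv : deriv γ 0 = v) (ht : |t| < δ) :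
    IsExpValue M x (t • v) (γ t) := by
  have hδ : 0 < δ := (abs_nonneg t).trans_lt ht
  -- This margin is small enough that `|t| (1 + ε) < δ`, keeping `s ↦ γ (t s)` inside the domain of
  -- `γ`.
  have hε : 0 < (δ - |t|) / δ := div_pos (sub_pos.2 ht) hδ
  have hmaps : ∀ s ∈ Ioo (-((δ - |t|) / δ)) (1 + (δ - |t|) / δ), t * s ∈ Ioo (-δ) δ := by
    intro s hs
    have h1 : |s| ≤ 1 + (δ - |t|) / δ := abs_le.2 ⟨by linarith [hs.1], hs.2.le⟩
    have h2 : |t| * (1 + (δ - |t|) / δ) < δ := by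
      have h3 : |t| * ((δ - |t|) / δ) < δ - |t| := by
        rw [mul_div_assoc', div_lt_iff₀ hδ]
        nlinarith
      linarith
    rw [mem_Ioo, ← abs_lt, abs_mul]
    exact (mul_le_mul_of_nonneg_left h1 (abs_nonneg t)).trans_lt h2
  have hd : deriv (fun s => γ (t * s)) = fun s => t • deriv γ (t * s) :=
    funext fun s => deriv_comp_mul_left t γ s
  refine ⟨fun s => γ (t * s), (δ - |t|) / δ, hε, ⟨?_, fun s hs => hγ.2.1 _ (hmaps s hs),
    fun s hs => ?_⟩, by simpa using h0, by simp [hd, hv], by simp⟩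
  · exact hγ.1.comp (contDiff_const.mul contDiff_id).contDiffOn hmaps
  · have h2 : deriv (deriv fun s => γ (t * s)) s = t • t • deriv (deriv γ) (t * s) := by
      rw [hd, deriv_fun_const_smul_field, deriv_comp_mul_left]
    have h3 := hγ.2.2 _ (hmaps s hs)
    rw [intrinsicAcceleration] at h3 ⊢
    rw [h2, map_smul, map_smul, h3, smul_zero, smul_zero]

end Geodesic

/-- The geodesic equation of `{F = 0}` as a first-order system in the ambient space. -/
noncomputable def geodesicField {n c : ℕ}
    (F : EuclideanSpace ℝ (Fin n) → EuclideanSpace ℝ (Fin c))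
    (z : EuclideanSpace ℝ (Fin n) × EuclideanSpace ℝ (Fin n)) :
    EuclideanSpace ℝ (Fin n) × EuclideanSpace ℝ (Fin n) :=
  (z.2, -normalLift (fderiv ℝ F z.1) (fderiv ℝ (fderiv ℝ F) z.1 z.2 z.2))

namespace IsLocalDefining

variable {n c : ℕ} {M U : Set (EuclideanSpace ℝ (Fin n))}
  {F : EuclideanSpace ℝ (Fin n) → EuclideanSpace ℝ (Fin c)} {x v : EuclideanSpace ℝ (Fin n)}

theorem contDiffAt_fderiv (h : IsLocalDefining M U F) (hx : x ∈ U) :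
    ContDiffAt ℝ 2 (fderiv ℝ F) x :=
  (h.contDiffAt hx).fderiv_right (by norm_num)

/-- The field involves `F''`, so it is `C¹` because `F` is `C³`. -/
theorem contDiffAt_geodesicField (h : IsLocalDefining M U F) (hx : x ∈ U) :
    ContDiffAt ℝ 1 (geodesicField F) (x, v) := by
  have h1 : ContDiffAt ℝ 1 (fun z : EuclideanSpace ℝ (Fin n) × EuclideanSpace ℝ (Fin n) =>
      normalLift (fderiv ℝ F z.1)) (x, v) :=
    ((contDiffAt_normalLift (h.surjective x hx)).comp x
      ((h.contDiffAt_fderiv hx).of_le (by norm_num))).comp (x, v) contDiffAt_fst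
  have h2 : ContDiffAt ℝ 1 (fun z : EuclideanSpace ℝ (Fin n) × EuclideanSpace ℝ (Fin n) =>
      fderiv ℝ (fderiv ℝ F) z.1) (x, v) :=
    ((h.contDiffAt_fderiv hx).fderiv_right (m := 1) (by norm_num)).comp (x, v) contDiffAt_fst
  exact contDiffAt_snd.prodMk
    (h1.clm_apply ((h2.clm_apply contDiffAt_snd).clm_apply contDiffAt_snd)).neg

theorem hasDerivAt_fderiv_apply (h : IsLocalDefining M U F) {γ w : ℝ → EuclideanSpace ℝ (Fin n)}
    {γ' w' : EuclideanSpace ℝ (Fin n)} {t : ℝ} (ht : γ t ∈ U) (hγ : HasDerivAt γ γ' t)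
    (hw : HasDerivAt w w' t) :
    HasDerivAt (fun s => fderiv ℝ F (γ s) (w s))
      (fderiv ℝ (fderiv ℝ F) (γ t) γ' (w t) + fderiv ℝ F (γ t) w') t :=
  (HasFDerivAt.comp_hasDerivAt t
    (((h.contDiffAt_fderiv ht).differentiableAt (by norm_num)).hasFDerivAt) hγ).clm_apply hw

/-- Differentiating `F'(γ) γ' = 0` gives `F'(γ) γ'' = -F''(γ)(γ', γ')`, which determines `γ''`
because it is normal. -/
theorem hasDerivAt_of_isGeodesicOn (h : IsLocalDefining M U F) {γ : ℝ → EuclideanSpace ℝ (Fin n)}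
    {I : Set ℝ} {t : ℝ} (hγ : IsGeodesicOn M γ I) (hI : IsOpen I) (ht : t ∈ I) (htU : γ t ∈ U) :
    HasDerivAt (fun s => (γ s, deriv γ s)) (geodesicField F (γ t, deriv γ t)) t := by
  have h1 := hγ.hasDerivAt hI ht
  have h2 := hγ.hasDerivAt_deriv hI ht
  have h3 := h.hasDerivAt_fderiv_apply htU h1 h2
  have h4 : (fun s => fderiv ℝ F (γ s) (deriv γ s)) =ᶠ[𝓝 t] fun _ => 0 := by
    filter_upwards [hI.mem_nhds ht, h1.continuousAt.eventually (h.isOpen.mem_nhds htU)] with s hs hsU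
    exact (h.mem_tangentSpace_iff hsU (hγ.2.1 s hs)).1 (hγ.deriv_mem_tangentSpace hI hs)
  have h5 := (h3.congr_of_eventuallyEq h4.symm).unique (hasDerivAt_const _ _)
  have h6 : deriv (deriv γ) t =
      -normalLift (fderiv ℝ F (γ t)) (fderiv ℝ (fderiv ℝ F) (γ t) (deriv γ t) (deriv γ t)) := by
    rw [eq_normalLift_of_orthogonal (h.surjective _ htU) fun w hw =>
      hγ.inner_deriv_deriv ht ((h.mem_tangentSpace_iff htU (hγ.2.1 t ht)).2 hw),
      eq_neg_of_add_eq_zero_right h5, map_neg]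
  have h7 := h1.prodMk h2
  rwa [h6] at h7

/-- Constant speed `‖u‖ < r` keeps position and velocity in a ball around `(x, 0)` up to time `1`.
The field is Lipschitz there, so ODE uniqueness applies to any two candidates. -/
theorem exists_isExpValue_unique (h : IsLocalDefining M U F) (hx : x ∈ U) :
    ∃ r > 0, ∀ u, ‖u‖ < r → ∀ y₁ y₂, IsExpValue M x u y₁ → IsExpValue M x u y₂ → y₁ = y₂ := by
  obtain ⟨K, s, hs, hK⟩ := (h.contDiffAt_geodesicField (v := 0) hx).exists_lipschitzOnWith
  have hU : ∀ᶠ z : EuclideanSpace ℝ (Fin n) × EuclideanSpace ℝ (Fin n) in 𝓝 (x, 0), z.1 ∈ U :=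
    continuous_fst.continuousAt.eventually (h.isOpen.mem_nhds hx)
  obtain ⟨r, hr, hball⟩ := Metric.eventually_nhds_iff_ball.1 (hU.and hs)
  refine ⟨r, hr, fun u hu => ?_⟩
  have key : ∀ y, IsExpValue M x u y → ∃ γ : ℝ → EuclideanSpace ℝ (Fin n), γ 0 = x ∧ deriv γ 0 = u ∧
      γ 1 = y ∧ ∀ t ∈ Icc (0 : ℝ) 1, (γ t, deriv γ t) ∈ Metric.ball (x, 0) r ∧
        HasDerivAt (fun s => (γ s, deriv γ s)) (geodesicField F (γ t, deriv γ t)) t := by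
    rintro y ⟨γ, ε, hε, hγ, h0, hu0, h1⟩
    have hsub : Icc (0 : ℝ) 1 ⊆ Ioo (-ε) (1 + ε) :=
      fun t ht => ⟨by linarith [ht.1], by linarith [ht.2]⟩
    have hb : ∀ t ∈ Icc (0 : ℝ) 1, (γ t, deriv γ t) ∈ Metric.ball (x, 0) r := by
      intro t ht
      have hn : ∀ t ∈ Icc (0 : ℝ) 1, ‖deriv γ t‖ = ‖u‖ := fun t ht => by
        rw [hγ.norm_deriv_eq isOpen_Ioo isPreconnected_Ioo (hsub (left_mem_Icc.2 zero_le_one)) (hsub ht),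
          hu0]
      have hd : ‖γ t - γ 0‖ ≤ ‖u‖ * ‖t - 0‖ :=
        (convex_Icc (0 : ℝ) 1).norm_image_sub_le_of_norm_hasDerivWithin_le
          (fun t ht => (hγ.hasDerivAt isOpen_Ioo (hsub ht)).hasDerivWithinAt)
          (fun t ht => (hn t ht).le) (left_mem_Icc.2 zero_le_one) ht
      have ht1 : ‖t - 0‖ ≤ 1 := by rw [sub_zero, Real.norm_of_nonneg ht.1]; exact ht.2
      rw [mem_ball_iff_norm, Prod.norm_def, max_lt_iff]
      refine ⟨?_, by simpa [hn t ht] using hu⟩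
      rw [h0] at hd
      exact (hd.trans (mul_le_of_le_one_right (norm_nonneg _) ht1)).trans_lt hu
    exact ⟨γ, h0, hu0, h1, fun t ht => ⟨hb t ht,
      h.hasDerivAt_of_isGeodesicOn hγ isOpen_Ioo (hsub ht) (hball _ (hb t ht)).1⟩⟩
  intro y₁ y₂ h₁ h₂
  obtain ⟨γ₁, h₁0, h₁u, h₁1, h₁⟩ := key y₁ h₁
  obtain ⟨γ₂, h₂0, h₂u, h₂1, h₂⟩ := key y₂ h₂
  have := ODE_solution_unique_of_mem_Icc_right (v := fun _ => geodesicField F) (s := fun _ => s)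
    (f := fun t => (γ₁ t, deriv γ₁ t)) (g := fun t => (γ₂ t, deriv γ₂ t)) (a := 0) (b := 1)
    (fun _ _ => hK)
    (fun t ht => (h₁ t ht).2.continuousAt.continuousWithinAt)
    (fun t ht => (h₁ t (Ico_subset_Icc_self ht)).2.hasDerivWithinAt)
    (fun t ht => (hball _ (h₁ t (Ico_subset_Icc_self ht)).1).2)
    (fun t ht => (h₂ t ht).2.continuousAt.continuousWithinAt)
    (fun t ht => (h₂ t (Ico_subset_Icc_self ht)).2.hasDerivWithinAt)
    (fun t ht => (hball _ (h₂ t (Ico_subset_Icc_self ht)).1).2)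
    (by simp [h₁0, h₂0, h₁u, h₂u]) (right_mem_Icc.2 zero_le_one)
  rw [← h₁1, ← h₂1]
  exact congrArg Prod.fst this

theorem exists_isGeodesicOn (h : IsLocalDefining M U F) (hx : x ∈ U) (hxM : x ∈ M)
    (hv : v ∈ tangentSpace M x) : ∃ δ > 0, ∃ γ : ℝ → EuclideanSpace ℝ (Fin n),
      IsGeodesicOn M γ (Ioo (-δ) δ) ∧ γ 0 = x ∧ deriv γ 0 = v := by
  obtain ⟨r, hr, ε, hε, hα⟩ := (h.contDiffAt_geodesicField (v := v)
    hx).exists_forall_mem_closedBall_exists_eq_forall_mem_Ioo_hasDerivAt 0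
  obtain ⟨α, hα0, hα⟩ := hα (x, v) (Metric.mem_closedBall_self hr.le)
  simp only [zero_sub, zero_add] at hα
  have hα1 : ContinuousAt (fun t => (α t).1) 0 :=
    (hα 0 (by simpa using hε)).continuousAt.fst
  have hU : ∀ᶠ t in 𝓝 0, (α t).1 ∈ U :=
    hα1.eventually (h.isOpen.mem_nhds (by simpa [hα0] using hx))
  obtain ⟨δ', hδ', hδU⟩ := Metric.eventually_nhds_iff_ball.1 hU
  set δ := min δ' ε
  have hδ : 0 < δ := lt_min hδ' hε
  have h0δ : (0 : ℝ) ∈ Ioo (-δ) δ := by simpa using hδ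
  have hsol : ∀ t ∈ Ioo (-δ) δ, (α t).1 ∈ U ∧ HasDerivAt (fun t => (α t).1) (α t).2 t ∧
      HasDerivAt (fun t => (α t).2) (geodesicField F (α t)).2 t := by
    intro t ht
    have h1 := hα t ⟨by linarith [ht.1, min_le_right δ' ε], ht.2.trans_le (min_le_right _ _)⟩
    refine ⟨hδU t ?_, h1.fst, h1.snd⟩
    rw [mem_ball_zero_iff, Real.norm_eq_abs]
    exact (abs_lt.2 ht).trans_le (min_le_left _ _)
  -- The ambient solution stays on `M` by two conservation laws: first `F'(α₁) α₂` is constant,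
  -- hence zero, and then so is `F(α₁)`.
  have hB : ∀ t ∈ Ioo (-δ) δ, fderiv ℝ F (α t).1 (α t).2 = 0 := by
    have hd : ∀ t ∈ Ioo (-δ) δ, HasDerivAt (fun t => fderiv ℝ F (α t).1 (α t).2) 0 t := by
      intro t ht
      obtain ⟨htU, h1, h2⟩ := hsol t ht
      have h3 := h.hasDerivAt_fderiv_apply (γ := fun t => (α t).1) (w := fun t => (α t).2) htU h1 h2
      have h4 : fderiv ℝ (fderiv ℝ F) (α t).1 (α t).2 (α t).2 +
          fderiv ℝ F (α t).1 (geodesicField F (α t)).2 = 0 := by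
        simp [geodesicField, apply_normalLift (h.surjective _ htU)]
      rwa [h4] at h3
    intro t ht
    rw [isOpen_Ioo.is_const_of_deriv_eq_zero isPreconnected_Ioo
      (fun t ht => (hd t ht).differentiableAt.differentiableWithinAt)
      (fun t ht => (hd t ht).deriv) ht h0δ, hα0]
    exact (h.mem_tangentSpace_iff hx hxM).1 hv
  have hM : ∀ t ∈ Ioo (-δ) δ, (α t).1 ∈ M := by
    have hd : ∀ t ∈ Ioo (-δ) δ, HasDerivAt (fun t => F (α t).1) 0 t := by
      intro t ht
      obtain ⟨htU, h1, -⟩ := hsol t ht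
      have h3 := HasFDerivAt.comp_hasDerivAt t (h.hasFDerivAt htU) h1
      rwa [hB t ht] at h3
    intro t ht
    rw [h.mem_iff _ (hsol t ht).1, isOpen_Ioo.is_const_of_deriv_eq_zero isPreconnected_Ioo
      (fun t ht => (hd t ht).differentiableAt.differentiableWithinAt)
      (fun t ht => (hd t ht).deriv) ht h0δ, hα0]
    exact (h.mem_iff x hx).1 hxM
  have hd1 : ∀ t ∈ Ioo (-δ) δ, deriv (fun t => (α t).1) t = (α t).2 :=
    fun t ht => (hsol t ht).2.1.deriv
  have hd2 : ∀ t ∈ Ioo (-δ) δ, deriv (deriv fun t => (α t).1) t = (geodesicField F (α t)).2 := by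
    intro t ht
    have he : deriv (fun t => (α t).1) =ᶠ[𝓝 t] fun t => (α t).2 :=
      (isOpen_Ioo.eventually_mem ht).mono hd1
    rw [he.deriv_eq]
    exact (hsol t ht).2.2.deriv
  refine ⟨δ, hδ, fun t => (α t).1, ⟨?_, hM, fun t ht => ?_⟩, by simp [hα0], by
    rw [hd1 0 h0δ, hα0]⟩
  · have hc1 : ContDiffOn ℝ 1 (fun t => (α t).2) (Ioo (-δ) δ) := by
      rw [show (1 : WithTop ℕ∞) = 0 + 1 from (zero_add 1).symm,
        contDiffOn_succ_iff_deriv_of_isOpen isOpen_Ioo]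
      refine ⟨fun t ht => (hsol t ht).2.2.differentiableAt.differentiableWithinAt, by simp,
        contDiffOn_zero.2 ?_⟩
      refine ContinuousOn.congr (f := fun t => (geodesicField F (α t)).2) (fun t ht => ?_)
        fun t ht => (hsol t ht).2.2.deriv
      have hαc : ContinuousAt α t :=
        (hsol t ht).2.1.continuousAt.prodMk (hsol t ht).2.2.continuousAt
      have hfc : ContinuousAt (geodesicField F) (α t) :=
        (h.contDiffAt_geodesicField (v := (α t).2) (hsol t ht).1).continuousAt
      exact (hfc.comp hαc).snd.continuousWithinAt
    rw [show (2 : WithTop ℕ∞) = 1 + 1 from one_add_one_eq_two.symm,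
      contDiffOn_succ_iff_deriv_of_isOpen isOpen_Ioo]
    exact ⟨fun t ht => (hsol t ht).2.1.differentiableAt.differentiableWithinAt, by simp,
      hc1.congr hd1⟩
  · rw [intrinsicAcceleration, starProjection_eq_zero_iff, hd2 t ht]
    intro w hw
    have := inner_normalLift (fderiv ℝ F (α t).1)
      (fderiv ℝ (fderiv ℝ F) (α t).1 (α t).2 (α t).2)
      ((h.mem_tangentSpace_iff (hsol t ht).1 (hM t ht)).1 hw)
    simp [geodesicField, this]

end IsLocalDefining

/-! ### Existence and uniqueness of nearest points -/

theorem inner_eq_zero_of_mem_nearestPoints {n : ℕ} {M : Set (EuclideanSpace ℝ (Fin n))}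
    {y z w : EuclideanSpace ℝ (Fin n)} (hy : y ∈ nearestPoints M z) (hw : w ∈ tangentSpace M y) :
    inner ℝ (z - y) w = 0 := by
  induction hw using Submodule.span_induction with
  | mem w hw =>
    obtain ⟨γ, h0, hM, hγ⟩ := hw
    have hmin : IsLocalMin (fun t => ‖γ t - z‖ ^ 2) 0 := by
      filter_upwards [hM] with t ht
      rw [h0]
      exact pow_le_pow_left₀ (norm_nonneg _) (hy.2 _ ht) 2
    have h := hmin.hasDerivAt_eq_zero (hγ.sub_const z).norm_sq
    rw [h0] at h
    rw [← neg_sub, inner_neg_left]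
    linarith
  | zero => exact inner_zero_right _
  | add a b _ _ ha hb => rw [inner_add_right, ha, hb, add_zero]
  | smul c a _ ha => rw [inner_smul_right, ha, mul_zero]

theorem norm_sub_le_of_mem_nearestPoints {n : ℕ} {M : Set (EuclideanSpace ℝ (Fin n))}
    {x y z : EuclideanSpace ℝ (Fin n)} (hxM : x ∈ M)
    (hy : y ∈ nearestPoints M z) : ‖y - x‖ ≤ 2 * ‖z - x‖ := by
  have h1 := hy.2 x hxM
  have h2 := norm_sub_le_norm_sub_add_norm_sub y z x
  rw [norm_sub_rev x z] at h1
  linarith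

theorem tendsto_of_mem_nearestPoints {n : ℕ} {M : Set (EuclideanSpace ℝ (Fin n))}
    {x : EuclideanSpace ℝ (Fin n)} (hxM : x ∈ M) {p z : ℝ → EuclideanSpace ℝ (Fin n)}
    (hz : Tendsto z (𝓝 0) (𝓝 x)) (hp : ∀ᶠ t in 𝓝 0, p t ∈ nearestPoints M (z t)) :
    Tendsto p (𝓝 0) (𝓝 x) := by
  rw [tendsto_iff_norm_sub_tendsto_zero] at hz ⊢
  refine squeeze_zero' (Eventually.of_forall fun t => norm_nonneg _)
    (hp.mono fun t ht => norm_sub_le_of_mem_nearestPoints hxM ht) ?_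
  simpa using hz.const_mul 2

namespace IsLocalDefining

variable {n c : ℕ} {M U : Set (EuclideanSpace ℝ (Fin n))}
  {F : EuclideanSpace ℝ (Fin n) → EuclideanSpace ℝ (Fin c)} {x v : EuclideanSpace ℝ (Fin n)}

/-- With `F` zero at both ends, this is the mean value estimate for `F - F'(p)`, whose derivative is
small by the Lipschitz bound on `F'`. -/
theorem exists_norm_fderiv_sub_le (h : IsLocalDefining M U F) (hx : x ∈ U) :
    ∃ K : ℝ, 0 ≤ K ∧ ∀ᶠ z in 𝓝 (x, x), z.1 ∈ M → z.2 ∈ M →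
      ‖fderiv ℝ F z.1 (z.2 - z.1)‖ ≤ K * ‖z.2 - z.1‖ ^ 2 := by
  obtain ⟨K, s, hs, hK⟩ := ((h.contDiffAt_fderiv hx).of_le (by norm_num)).exists_lipschitzOnWith
  obtain ⟨r, hr, hball⟩ := Metric.eventually_nhds_iff_ball.1 ((h.isOpen.eventually_mem hx).and hs)
  refine ⟨K, K.2, ?_⟩
  filter_upwards [prod_mem_nhds (Metric.ball_mem_nhds x hr) (Metric.ball_mem_nhds x hr)]
  rintro ⟨p, q⟩ ⟨hp, hq⟩ hpM hqM
  simp only at *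
  have hsub : segment ℝ p q ⊆ Metric.ball x r := (convex_ball x r).segment_subset hp hq
  have h1 := (convex_segment p q).norm_image_sub_le_of_norm_hasFDerivWithin_le' (f := F)
    (φ := fderiv ℝ F p) (C := K * ‖q - p‖)
    (fun y hy => (h.hasFDerivAt (hball y (hsub hy)).1).hasFDerivWithinAt)
    (fun y hy => (hK.norm_sub_le (hball y (hsub hy)).2 (hball p hp).2).trans
      (mul_le_mul_of_nonneg_left (norm_sub_le_of_mem_segment hy) K.2))
    (left_mem_segment ℝ p q) (right_mem_segment ℝ p q)
  rw [(h.mem_iff q (hball q hq).1).1 hqM, (h.mem_iff p (hball p hp).1).1 hpM, sub_zero, zero_sub,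
    norm_neg] at h1
  linarith

/-- Normal vectors at `p` are almost orthogonal to secants of `M` through `p`. -/
theorem exists_abs_inner_secant_le (h : IsLocalDefining M U F) (hx : x ∈ U) :
    ∃ C : ℝ, 0 ≤ C ∧ ∀ᶠ z in 𝓝 (x, x), z.1 ∈ M → z.2 ∈ M → ∀ u,
      (∀ w ∈ tangentSpace M z.1, inner ℝ u w = 0) →
      |inner ℝ u (z.2 - z.1)| ≤ C * ‖u‖ * ‖z.2 - z.1‖ ^ 2 := by
  obtain ⟨K, hK0, hK⟩ := h.exists_norm_fderiv_sub_le hx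
  have hN : ContinuousAt (fun y => ‖normalLift (fderiv ℝ F y)‖) x :=
    (ContinuousAt.comp (f := fderiv ℝ F)
      (contDiffAt_normalLift (k := 0) (h.surjective x hx)).continuousAt
      (h.contDiffAt_fderiv hx).continuousAt).norm
  have hN' := hN.eventually (eventually_lt_nhds (lt_add_one _))
  refine ⟨(‖normalLift (fderiv ℝ F x)‖ + 1) * K, by positivity, ?_⟩
  filter_upwards [hK, continuous_fst.continuousAt.eventually hN',
    continuous_fst.continuousAt.eventually (h.isOpen.eventually_mem hx)]
  rintro ⟨p, q⟩ h1 h2 hpU hpM hqM u hu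
  simp only at *
  calc |inner ℝ u (q - p)|
      ≤ ‖u‖ * (‖normalLift (fderiv ℝ F p)‖ * ‖fderiv ℝ F p (q - p)‖) :=
        abs_inner_le_of_orthogonal (h.surjective p hpU)
          (fun w hw => hu w ((h.mem_tangentSpace_iff hpU hpM).2 hw)) _
    _ ≤ ‖u‖ * ((‖normalLift (fderiv ℝ F x)‖ + 1) * (K * ‖q - p‖ ^ 2)) := by
        gcongr
        exact h1 hpM hqM
    _ = _ := by ring

theorem eventually_exists_mem_nearestPoints (h : IsLocalDefining M U F) (hx : x ∈ U)
    (hxM : x ∈ M) : ∀ᶠ z in 𝓝 x, ∃ y, y ∈ nearestPoints M z := by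
  obtain ⟨ρ, hρ, hρU⟩ := Metric.nhds_basis_closedBall.mem_iff.1 (h.isOpen.mem_nhds hx)
  have hcpt : IsCompact (M ∩ Metric.closedBall x ρ) := by
    have h1 : M ∩ Metric.closedBall x ρ = Metric.closedBall x ρ ∩ F ⁻¹' {0} := by
      ext y
      constructor
      · rintro ⟨h1, h2⟩
        exact ⟨h2, (h.mem_iff y (hρU h2)).1 h1⟩
      · rintro ⟨h1, h2⟩
        exact ⟨(h.mem_iff y (hρU h1)).2 h2, h1⟩
    rw [h1]
    exact (isCompact_closedBall x ρ).of_isClosed_subset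
      ((h.contDiffOn.continuousOn.mono hρU).preimage_isClosed_of_isClosed
        Metric.isClosed_closedBall isClosed_singleton) inter_subset_left
  filter_upwards [Metric.ball_mem_nhds x (half_pos hρ)] with z hz
  have hz' : ‖x - z‖ < ρ / 2 := by rw [norm_sub_rev]; exact mem_ball_iff_norm.1 hz
  have hxρ : x ∈ M ∩ Metric.closedBall x ρ := ⟨hxM, Metric.mem_closedBall_self hρ.le⟩
  obtain ⟨y, hy, hmin⟩ := hcpt.exists_isMinOn (f := fun y => ‖y - z‖) ⟨x, hxρ⟩ (by fun_prop)
  refine ⟨y, hy.1, fun w hw => ?_⟩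
  by_cases hwρ : w ∈ Metric.closedBall x ρ
  · exact hmin ⟨hw, hwρ⟩
  -- Points outside the ball lie farther than `ρ/2` from `z`, whereas `x` is closer than `ρ/2`.
  · have h1 : ‖y - z‖ ≤ ‖x - z‖ := hmin hxρ
    have h2 : ρ < ‖w - x‖ := by simpa [dist_eq_norm] using hwρ
    have h3 := norm_sub_le_norm_sub_add_norm_sub w z x
    rw [norm_sub_rev z x] at h3
    linarith

theorem eventually_existsUnique_mem_nearestPoints (h : IsLocalDefining M U F) (hx : x ∈ U)
    (hxM : x ∈ M) : ∀ᶠ z in 𝓝 x, ∃! y, y ∈ nearestPoints M z := by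
  obtain ⟨C, hC0, hC⟩ := h.exists_abs_inner_secant_le hx
  rw [nhds_prod_eq] at hC
  obtain ⟨V, hV, hCV⟩ := mem_prod_self_iff.1 hC
  obtain ⟨r, hr, hrV⟩ := Metric.mem_nhds_iff.1 hV
  have hsmall : ∀ᶠ z in 𝓝 x, 2 * ‖z - x‖ < r ∧ 2 * C * ‖z - x‖ < 1 := by
    have h1 : ContinuousAt (fun z => 2 * ‖z - x‖) x := by fun_prop
    have h2 : ContinuousAt (fun z => 2 * C * ‖z - x‖) x := by fun_prop
    exact (h1.eventually (eventually_lt_nhds (by simpa using hr))).and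
      (h2.eventually (eventually_lt_nhds (by simp)))
  filter_upwards [h.eventually_exists_mem_nearestPoints hx hxM, hsmall] with z ⟨y, hy⟩ ⟨hz1, hz2⟩
  refine ⟨y, hy, fun y' hy' => ?_⟩
  have hb : ∀ q ∈ nearestPoints M z, q ∈ V ∧ ‖z - q‖ ≤ ‖z - x‖ := fun q hq =>
    ⟨hrV (mem_ball_iff_norm.2 ((norm_sub_le_of_mem_nearestPoints hxM hq).trans_lt hz1)), by
      rw [norm_sub_rev z q, norm_sub_rev z x]; exact hq.2 x hxM⟩
  have key : ∀ p ∈ nearestPoints M z, ∀ q ∈ nearestPoints M z,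
      inner ℝ (z - p) (q - p) ≤ C * ‖z - x‖ * ‖q - p‖ ^ 2 := fun p hp q hq =>
    (le_abs_self _).trans ((hCV (mk_mem_prod (hb p hp).1 (hb q hq).1) hp.1 hq.1 _ fun w hw =>
      inner_eq_zero_of_mem_nearestPoints hp hw).trans (by gcongr; exact (hb p hp).2))
  have h1 := key y hy y' hy'
  have h2 := key y' hy' y hy
  -- Adding the secant bounds at the two minimizers gives `‖y' - y‖² ≤ 2C‖z - x‖ ‖y' - y‖²`, with
  -- factor below `1`.
  have h3 : inner ℝ (z - y) (y' - y) + inner ℝ (z - y') (y - y') = ‖y' - y‖ ^ 2 := by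
    rw [← neg_sub y' y, inner_neg_right, ← sub_eq_add_neg, ← inner_sub_left, sub_sub_sub_cancel_left,
      real_inner_self_eq_norm_sq]
  rw [norm_sub_rev y y'] at h2
  by_contra hne
  have h4 : 0 < ‖y' - y‖ ^ 2 := by
    have := norm_pos_iff.2 (sub_ne_zero.2 hne)
    positivity
  nlinarith

end IsLocalDefining

/-! ### Second-order comparison of geodesic and projection -/

theorem isLittleO_second_order {E : Type*} [NormedAddCommGroup E] [NormedSpace ℝ E] {γ : ℝ → E}
    {δ : ℝ} (hδ : 0 < δ) (hγ : ContDiffOn ℝ 2 γ (Ioo (-δ) δ)) :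
    (fun t => γ t - (γ 0 + t • deriv γ 0) - (t ^ 2 / 2) • deriv (deriv γ) 0) =o[𝓝 0]
      fun t => t ^ 2 := by
  have h0 : (0 : ℝ) ∈ Ioo (-δ) δ := by simpa using hδ
  have h := taylor_isLittleO (n := 2) (convex_Ioo (-δ) δ) h0 hγ
  rw [isOpen_Ioo.nhdsWithin_eq h0] at h
  refine h.congr (fun t => ?_) fun t => by simp
  rw [taylorWithinEval_succ, taylorWithinEval_succ, taylor_within_zero_eval,
    iteratedDerivWithin_of_isOpen isOpen_Ioo h0, iteratedDerivWithin_of_isOpen isOpen_Ioo h0,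
    show 1 + 1 = 2 from rfl, show 0 + 1 = 1 from rfl, iteratedDeriv_one,
    show iteratedDeriv 2 γ = deriv (deriv γ) by rw [iteratedDeriv_succ, iteratedDeriv_one]]
  norm_num [Nat.factorial, sub_sub, div_eq_inv_mul]

namespace IsLocalDefining

variable {n c : ℕ} {M U : Set (EuclideanSpace ℝ (Fin n))}
  {F : EuclideanSpace ℝ (Fin n) → EuclideanSpace ℝ (Fin c)} {x v : EuclideanSpace ℝ (Fin n)}

theorem isLittleO_sub_nearestPoint (h : IsLocalDefining M U F) (hx : x ∈ U)
    {γ p : ℝ → EuclideanSpace ℝ (Fin n)} {δ : ℝ} (hδ : 0 < δ)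
    (hγ : IsGeodesicOn M γ (Ioo (-δ) δ)) (h0 : γ 0 = x) (hv : deriv γ 0 = v)
    (hp : ∀ᶠ t : ℝ in 𝓝 0, p t ∈ nearestPoints M (x + t • v)) :
    (fun t => γ t - p t) =o[𝓝 0] fun t : ℝ => t ^ 2 := by
  have h0δ : (0 : ℝ) ∈ Ioo (-δ) δ := by simpa using hδ
  have hxM : x ∈ M := h0 ▸ hγ.2.1 0 h0δ
  set a := deriv (deriv γ) 0 with ha
  have haT : ∀ w, fderiv ℝ F x w = 0 → inner ℝ a w = 0 := fun w hw =>
    hγ.inner_deriv_deriv h0δ (h0.symm ▸ (h.mem_tangentSpace_iff hx hxM).2 hw)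
  have hr := isLittleO_second_order hδ hγ.1
  rw [h0, hv, ← ha] at hr
  have hγx : Tendsto γ (𝓝 0) (𝓝 x) := h0 ▸ (hγ.hasDerivAt isOpen_Ioo h0δ).continuousAt
  have hzx : Tendsto (fun t : ℝ => x + t • v) (𝓝 0) (𝓝 x) := by
    have : ContinuousAt (fun t : ℝ => x + t • v) 0 := by fun_prop
    simpa [ContinuousAt] using this
  have hpx : Tendsto p (𝓝 0) (𝓝 x) := tendsto_of_mem_nearestPoints hxM hzx hp
  obtain ⟨C, hC0, hC⟩ := h.exists_abs_inner_secant_le hx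
  have hC' := (hpx.prodMk_nhds hγx).eventually hC
  have hCsmall : ∀ᶠ t : ℝ in 𝓝 0, C * ‖x + t • v - p t‖ < 1 / 2 := by
    have h1 : Tendsto (fun t : ℝ => C * ‖x + t • v - p t‖) (𝓝 0) (𝓝 0) := by
      simpa using ((hzx.sub hpx).norm.const_mul C)
    exact h1.eventually (eventually_lt_nhds (by norm_num))
  -- Strict differentiability is essential: both endpoints `γ t` and `p t` move, and the error must
  -- be relative to their difference.
  have hstrict := ((h.contDiffAt hx).hasStrictFDerivAt (by norm_num)).isLittleO.comp_tendsto
    (hγx.prodMk_nhds hpx)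
  set L := ‖a‖ * ‖normalLift (fderiv ℝ F x)‖ with hL
  have hL0 : 0 ≤ L := by positivity
  refine Asymptotics.isLittleO_iff.2 fun ε hε => ?_
  filter_upwards [hp, hC', hCsmall, isOpen_Ioo.eventually_mem h0δ,
    hγx.eventually (h.isOpen.eventually_mem hx), hpx.eventually (h.isOpen.eventually_mem hx),
    Asymptotics.isLittleO_iff.1 hr (show 0 < ε / 4 by positivity),
    Asymptotics.isLittleO_iff.1 hstrict (show 0 < ε / (2 * (L + 1)) by positivity)]
    with t hpt hCt hst htδ hγU hpU hrt hBt
  set z := x + t • v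
  set d := γ t - p t with hd
  set e := γ t - z - (t ^ 2 / 2) • a with he
  have hγM := hγ.2.1 t htδ
  simp only [Function.comp_apply, (h.mem_iff _ hγU).1 hγM, (h.mem_iff _ hpU).1 hpt.1, sub_zero,
    zero_sub, norm_neg] at hBt
  have ht2 : ‖t ^ 2‖ = t ^ 2 := by simp
  rw [ht2] at hrt ⊢
  have h1 : inner ℝ (z - p t) d ≤ 1 / 2 * ‖d‖ ^ 2 :=
    (le_abs_self _).trans ((hCt hpt.1 hγM _ fun w hw =>
      inner_eq_zero_of_mem_nearestPoints hpt hw).trans (by gcongr))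
  have h2 : inner ℝ a d ≤ ε / 2 * ‖d‖ :=
    calc inner ℝ a d ≤ ‖a‖ * (‖normalLift (fderiv ℝ F x)‖ * ‖fderiv ℝ F x d‖) :=
          (le_abs_self _).trans (abs_inner_le_of_orthogonal (h.surjective x hx) haT d)
      _ ≤ ‖a‖ * (‖normalLift (fderiv ℝ F x)‖ * (ε / (2 * (L + 1)) * ‖d‖)) := by gcongr
      _ = L / (L + 1) * (ε / 2 * ‖d‖) := by rw [hL]; field_simp
      _ ≤ 1 * (ε / 2 * ‖d‖) := by
          gcongr
          rw [div_le_one (by positivity)]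
          linarith
      _ = ε / 2 * ‖d‖ := one_mul _
  have h3 : inner ℝ e d ≤ ε / 4 * t ^ 2 * ‖d‖ :=
    (real_inner_le_norm _ _).trans (by gcongr)
  have h4 : ‖d‖ ^ 2 = t ^ 2 / 2 * inner ℝ a d + inner ℝ e d + inner ℝ (z - p t) d := by
    rw [← real_inner_smul_left, ← inner_add_left, ← inner_add_left, ← real_inner_self_eq_norm_sq]
    congr 1
    rw [hd, he]
    abel
  have h5 : t ^ 2 / 2 * inner ℝ a d ≤ t ^ 2 / 2 * (ε / 2 * ‖d‖) := by gcongr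
  by_contra! hlt
  have hd0 : 0 < ‖d‖ := lt_of_le_of_lt (by positivity) hlt
  -- The bounds combine to `‖d‖²/2 ≤ (ε/2) t² ‖d‖`, contradicting `ε t² < ‖d‖`.
  nlinarith [mul_lt_mul_of_pos_right hlt hd0]

end IsLocalDefining

theorem tendsto_riemannianDist_div {n : ℕ} {M : Set (EuclideanSpace ℝ (Fin n))}
    {p q : ℝ → EuclideanSpace ℝ (Fin n)} {C : NNReal} {i : ℕ}
    (hC : ∀ᶠ t in 𝓝[≠] (0 : ℝ), riemannianDist M (p t) (q t) ≤ C * ‖q t - p t‖ₑ)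
    (ho : (fun t => q t - p t) =o[𝓝 0] fun t : ℝ => t ^ i) :
    Tendsto (fun t : ℝ => riemannianDist M (p t) (q t) / ‖t‖ₑ ^ i) (𝓝[≠] 0) (𝓝 0) := by
  have h1 : Tendsto (fun t : ℝ => ENNReal.ofReal (‖q t - p t‖ / ‖t ^ i‖)) (𝓝[≠] 0) (𝓝 0) := by
    rw [← ENNReal.ofReal_zero]
    exact ENNReal.tendsto_ofReal ((ho.norm_norm.tendsto_div_nhds_zero).mono_left nhdsWithin_le_nhds)
  have h2 : Tendsto (fun t : ℝ => (C : ENNReal) * ENNReal.ofReal (‖q t - p t‖ / ‖t ^ i‖))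
      (𝓝[≠] 0) (𝓝 0) := by
    simpa using ENNReal.Tendsto.const_mul h1 (Or.inr ENNReal.coe_ne_top)
  refine tendsto_of_tendsto_of_tendsto_of_le_of_le' tendsto_const_nhds h2
    (Eventually.of_forall fun t => bot_le) ?_
  filter_upwards [hC, self_mem_nhdsWithin] with t ht ht0
  have ht0' : t ≠ 0 := ht0
  rw [ENNReal.ofReal_div_of_pos (norm_pos_iff.2 (pow_ne_zero i ht0')), ofReal_norm, ofReal_norm, enorm_pow, ← mul_div_assoc]
  exact ENNReal.div_le_div_right ht _

theorem expMap_eq {n : ℕ} {M : Set (EuclideanSpace ℝ (Fin n))} {x v y : EuclideanSpace ℝ (Fin n)}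
    (h : (x, v) ∈ expDomain M) (hy : IsExpValue M x v y) : expMap M x v = y :=
  h.2.2.unique (Classical.epsilon_spec ⟨y, hy⟩) hy

theorem projRetraction_eq {n : ℕ} {M : Set (EuclideanSpace ℝ (Fin n))}
    {x v y : EuclideanSpace ℝ (Fin n)} (h : (x, v) ∈ projDomain M)
    (hy : y ∈ nearestPoints M (x + v)) : projRetraction M x v = y :=
  h.2.2.unique (Classical.epsilon_spec (p := fun y => y ∈ nearestPoints M (x + v)) ⟨y, hy⟩) hy

theorem projRetraction_mem {n : ℕ} {M : Set (EuclideanSpace ℝ (Fin n))}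
    {x v : EuclideanSpace ℝ (Fin n)} (h : (x, v) ∈ projDomain M) :
    projRetraction M x v ∈ nearestPoints M (x + v) :=
  Classical.epsilon_spec (p := fun y => y ∈ nearestPoints M (x + v)) h.2.2.exists

theorem IsSubmanifold.projAgreesWithExp {n c : ℕ} {k : WithTop ℕ∞} (hk : 3 ≤ k)
    {M : Set (EuclideanSpace ℝ (Fin n))} (hM : IsSubmanifold k c M) {x v : EuclideanSpace ℝ (Fin n)}
    (hxM : x ∈ M) (hv : v ∈ tangentSpace M x) :
    (∀ᶠ t : ℝ in 𝓝 0, (x, t • v) ∈ projDomain M ∧ (x, t • v) ∈ expDomain M) ∧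
      ProjAgreesWithExp M 2 x v := by
  obtain ⟨U, F, hx, h⟩ := hM.exists_isLocalDefining hk hxM
  obtain ⟨δ, hδ, γ, hγ, h0, hv0⟩ := h.exists_isGeodesicOn hx hxM hv
  obtain ⟨r, hr, huniq⟩ := h.exists_isExpValue_unique hx
  obtain ⟨C, hC⟩ := h.exists_riemannianDist_le hx
  have h0δ : (0 : ℝ) ∈ Ioo (-δ) δ := by simpa using hδ
  have hexp : ∀ᶠ t : ℝ in 𝓝 0, (x, t • v) ∈ expDomain M ∧ IsExpValue M x (t • v) (γ t) := by
    have h1 : ContinuousAt (fun t : ℝ => ‖t • v‖) 0 := by fun_prop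
    filter_upwards [isOpen_Ioo.eventually_mem h0δ,
      h1.eventually (eventually_lt_nhds (by simpa using hr))] with t ht htr
    have h2 := hγ.isExpValue h0 hv0 (abs_lt.2 ht)
    exact ⟨⟨hxM, Submodule.smul_mem _ _ hv, γ t, h2, fun y hy => huniq _ htr _ _ hy h2⟩, h2⟩
  have hzx : Tendsto (fun t : ℝ => x + t • v) (𝓝 0) (𝓝 x) := by
    have : ContinuousAt (fun t : ℝ => x + t • v) 0 := by fun_prop
    simpa [ContinuousAt] using this
  have hproj : ∀ᶠ t : ℝ in 𝓝 0, (x, t • v) ∈ projDomain M :=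
    (hzx.eventually (h.eventually_existsUnique_mem_nearestPoints hx hxM)).mono fun t ht =>
      ⟨hxM, Submodule.smul_mem _ _ hv, ht⟩
  refine ⟨hproj.and (hexp.mono fun t ht => ht.1), ?_⟩
  have hnear : ∀ᶠ t : ℝ in 𝓝 0, projRetraction M x (t • v) ∈ nearestPoints M (x + t • v) :=
    hproj.mono fun t ht => projRetraction_mem ht
  have heq : ∀ᶠ t : ℝ in 𝓝 0, expMap M x (t • v) = γ t :=
    hexp.mono fun t ht => expMap_eq ht.1 ht.2
  have hγx : Tendsto γ (𝓝 0) (𝓝 x) := h0 ▸ (hγ.hasDerivAt isOpen_Ioo h0δ).continuousAt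
  have hpx : Tendsto (fun t : ℝ => projRetraction M x (t • v)) (𝓝 0) (𝓝 x) :=
    tendsto_of_mem_nearestPoints hxM hzx hnear
  refine tendsto_riemannianDist_div (C := C) ?_ ((h.isLittleO_sub_nearestPoint hx hδ hγ h0 hv0
    hnear).congr' (heq.mono fun t ht => by simp only [ht]) EventuallyEq.rfl)
  refine Eventually.filter_mono nhdsWithin_le_nhds ?_
  filter_upwards [(hpx.prodMk_nhds hγx).eventually hC, hnear, isOpen_Ioo.eventually_mem h0δ, heq]
    with t h1 h2 h3 h4
  rw [h4]
  exact h1 h2.1 (hγ.2.1 t h3)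

theorem enorm_sub_le_riemannianDist {n : ℕ} (M : Set (EuclideanSpace ℝ (Fin n)))
    (x y : EuclideanSpace ℝ (Fin n)) : ‖y - x‖ₑ ≤ riemannianDist M x y := by
  refine le_iInf₂ ?_
  rintro γ ⟨hγ, -, rfl, rfl⟩
  exact enorm_sub_le_lintegral_derivWithin_Icc_of_contDiffOn_Icc hγ zero_le_one

/-! ### Sharpness on the unit sphere -/

section Sphere

variable {n : ℕ} {x v y : EuclideanSpace ℝ (Fin n)}

theorem isSubmanifold_sphere (k : WithTop ℕ∞) :
    IsSubmanifold k 1 (Metric.sphere (0 : EuclideanSpace ℝ (Fin n)) 1) := by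
  intro x hx
  refine ⟨univ, fun y => (‖y‖ ^ 2 - 1) • EuclideanSpace.single 0 1, isOpen_univ, mem_univ x,
    (((contDiff_norm_sq ℝ).sub contDiff_const).smul contDiff_const).contDiffOn, ?_, ?_⟩
  · ext y
    have hn : ‖y‖ ≠ -1 := fun h => by linarith [norm_nonneg y]
    simp [sub_eq_zero, hn]
  · rintro y ⟨hy, -⟩ g
    have hd : HasFDerivAt (fun y : EuclideanSpace ℝ (Fin n) =>
        (‖y‖ ^ 2 - 1) • (EuclideanSpace.single 0 1 : EuclideanSpace ℝ (Fin 1)))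
        ((2 • innerSL ℝ y).smulRight (EuclideanSpace.single 0 1)) y :=
      ((hasStrictFDerivAt_norm_sq y).hasFDerivAt.sub_const 1).smul_const _
    have hy1 : ‖y‖ = 1 := by simpa using hy
    refine ⟨(g 0 / 2) • y, ?_⟩
    rw [hd.fderiv]
    ext i
    fin_cases i
    simp [hy1]

theorem mem_nearestPoints_sphere_smul (hy : ‖y‖ = 1) {s : ℝ} (hs : 0 ≤ s) :
    y ∈ nearestPoints (Metric.sphere 0 1) (s • y) := by
  refine ⟨by simpa using hy, fun w hw => ?_⟩
  have hw1 : ‖w‖ = 1 := by simpa using hw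
  have h1 : ‖y - s • y‖ = |1 - s| := by
    rw [show y - s • y = (1 - s) • y by rw [sub_smul, one_smul], norm_smul, hy, mul_one, Real.norm_eq_abs]
  have h2 := abs_norm_sub_norm_le w (s • y)
  rwa [hw1, norm_smul, hy, mul_one, Real.norm_of_nonneg hs, ← h1] at h2

/-- `y` is the point of the sphere nearest to `2y`, so the first-order condition makes `2y - y = y`
normal. -/
theorem inner_eq_zero_of_mem_tangentSpace_sphere (hy : ‖y‖ = 1) {w : EuclideanSpace ℝ (Fin n)}
    (hw : w ∈ tangentSpace (Metric.sphere 0 1) y) : inner ℝ y w = 0 := by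
  have h := inner_eq_zero_of_mem_nearestPoints (mem_nearestPoints_sphere_smul hy zero_le_two) hw
  rwa [two_smul, add_sub_cancel_right] at h

theorem norm_sq_add_smul (hx : ‖x‖ = 1) (hv : ‖v‖ = 1) (hxv : inner ℝ x v = 0) (a b : ℝ) :
    ‖a • x + b • v‖ ^ 2 = a ^ 2 + b ^ 2 := by
  rw [norm_add_sq_real, norm_smul, norm_smul, hx, hv, real_inner_smul_left, real_inner_smul_right,
    hxv]
  simp

theorem norm_greatCircle (hx : ‖x‖ = 1) (hv : ‖v‖ = 1) (hxv : inner ℝ x v = 0) (t : ℝ) :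
    ‖Real.cos t • x + Real.sin t • v‖ = 1 := by
  rw [← sq_eq_sq₀ (norm_nonneg _) zero_le_one, norm_sq_add_smul hx hv hxv, one_pow,
    Real.cos_sq_add_sin_sq]

theorem deriv_greatCircle (x v : EuclideanSpace ℝ (Fin n)) :
    deriv (fun t => Real.cos t • x + Real.sin t • v) =
      fun t => Real.cos t • v + Real.sin t • (-x) := by
  funext t
  refine HasDerivAt.deriv ?_
  have h := ((Real.hasDerivAt_cos t).smul_const x).add ((Real.hasDerivAt_sin t).smul_const v)
  rw [neg_smul, ← smul_neg, add_comm (Real.sin t • -x)] at h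
  exact h

theorem isGeodesicOn_greatCircle (hx : ‖x‖ = 1) (hv : ‖v‖ = 1) (hxv : inner ℝ x v = 0)
    (I : Set ℝ) : IsGeodesicOn (Metric.sphere 0 1)
      (fun t => Real.cos t • x + Real.sin t • v) I := by
  refine ⟨((Real.contDiff_cos.smul contDiff_const).add
    (Real.contDiff_sin.smul contDiff_const)).contDiffOn,
    fun t _ => by simpa using norm_greatCircle hx hv hxv t, fun t _ => ?_⟩
  rw [intrinsicAcceleration, starProjection_eq_zero_iff, deriv_greatCircle, deriv_greatCircle]
  intro w hw
  have h := inner_eq_zero_of_mem_tangentSpace_sphere (norm_greatCircle hx hv hxv t) hw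
  have h2 : Real.cos t • (-x) + Real.sin t • (-v) = -(Real.cos t • x + Real.sin t • v) := by
    simp only [smul_neg, neg_add]
  beta_reduce
  rw [h2, inner_neg_left, h, neg_zero]

/-- The leading term is `t³/3`; the constant `1/6` leaves room for the Taylor remainders. -/
theorem sin_sub_mul_cos_ge {t : ℝ} (h0 : 0 < t) (h1 : t ≤ 1) :
    t ^ 3 / 6 ≤ Real.sin t - t * Real.cos t := by
  have hs := Real.sin_gt_sub_cube h0
  have hc := (abs_le.1 (Real.cos_bound (x := t) (by rwa [abs_of_pos h0]))).2
  rw [abs_of_pos h0] at hc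
  have h2 : t ^ 5 ≤ t ^ 3 := pow_le_pow_of_le_one h0.le h1 (by norm_num)
  have h3 := mul_le_mul_of_nonneg_left hc h0.le
  have h4 : 0 < t ^ 3 := by positivity
  nlinarith

/-- Pairing the difference with the unit tangent of the great circle at time `t` leaves `(sin t - t
cos t)/r`, and `r ≤ 2` turns `1/6` into `1/12`. -/
theorem norm_greatCircle_sub_ge (hx : ‖x‖ = 1) (hv : ‖v‖ = 1) (hxv : inner ℝ x v = 0) {t : ℝ}
    (h0 : 0 < t) (h1 : t ≤ 1) :
    t ^ 3 / 12 ≤ ‖(Real.cos t • x + Real.sin t • v) - ‖x + t • v‖⁻¹ • (x + t • v)‖ := by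
  set r := ‖x + t • v‖ with hr
  have hr2 : r ^ 2 = 1 + t ^ 2 := by
    have := norm_sq_add_smul hx hv hxv 1 t
    rwa [one_smul, one_pow] at this
  have hr0 : 0 < r := by
    refine lt_of_le_of_ne (norm_nonneg _) fun h => ?_
    rw [← h] at hr2
    nlinarith
  have hr3 : r ≤ 2 := by nlinarith
  have hu : ‖Real.cos t • v + (-Real.sin t) • x‖ = 1 := by
    rw [← sq_eq_sq₀ (norm_nonneg _) zero_le_one,
      norm_sq_add_smul hv hx (by rwa [real_inner_comm]), neg_sq, one_pow, Real.cos_sq_add_sin_sq]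
  have hvx : inner ℝ v x = 0 := by rwa [real_inner_comm]
  have hin : inner ℝ ((Real.cos t • x + Real.sin t • v) - r⁻¹ • (x + t • v))
      (Real.cos t • v + (-Real.sin t) • x) = r⁻¹ * (Real.sin t - t * Real.cos t) := by
    simp only [inner_sub_left, inner_add_left, inner_add_right, real_inner_smul_left,
      real_inner_smul_right, hxv, hvx, real_inner_self_eq_norm_sq, hx, hv]
    ring
  have h2 := real_inner_le_norm ((Real.cos t • x + Real.sin t • v) - r⁻¹ • (x + t • v))
      (Real.cos t • v + (-Real.sin t) • x)
  rw [hin, hu, mul_one] at h2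
  refine le_trans ?_ h2
  rw [inv_mul_eq_div, le_div_iff₀ hr0]
  have h3 := sin_sub_mul_cos_ge h0 h1
  have h4 : 0 < t ^ 3 := by positivity
  nlinarith

theorem not_projAgreesWithExp_three_sphere (hx : ‖x‖ = 1) (hv : ‖v‖ = 1) (hxv : inner ℝ x v = 0) :
    v ∈ tangentSpace (Metric.sphere 0 1) x ∧
      ¬ ProjAgreesWithExp (Metric.sphere 0 1) 3 x v := by
  have hgeo := isGeodesicOn_greatCircle hx hv hxv (Ioo (-1) 1)
  have h00 : Real.cos 0 • x + Real.sin 0 • v = x := by simp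
  have hd0 : deriv (fun t => Real.cos t • x + Real.sin t • v) 0 = v := by
    rw [deriv_greatCircle]; simp
  have hvT : v ∈ tangentSpace (Metric.sphere 0 1) x := by
    have := hgeo.deriv_mem_tangentSpace isOpen_Ioo (t := 0) (by simp)
    rwa [hd0, h00] at this
  refine ⟨hvT, fun hlim => ?_⟩
  have hdom := ((isSubmanifold_sphere 3).projAgreesWithExp le_rfl
    (by simpa using hx) hvT).1
  -- A one-sided limit suffices: a single small `t > 0` with quotient below `1/12` contradicts the
  -- lower bound.
  have hlt : ∀ᶠ t in 𝓝[>] (0 : ℝ), riemannianDist (Metric.sphere 0 1)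
      (projRetraction (Metric.sphere 0 1) x (t • v)) (expMap (Metric.sphere 0 1) x (t • v)) /
        ‖t‖ₑ ^ 3 < ENNReal.ofReal (1 / 12) :=
    (hlim.mono_left (nhdsWithin_mono 0 fun t (ht : 0 < t) => ht.ne')).eventually
      (eventually_lt_nhds (by norm_num))
  obtain ⟨t, ht, ⟨hpd, hed⟩, h0, h1⟩ := (hlt.and ((hdom.filter_mono nhdsWithin_le_nhds).and
    (Ioo_mem_nhdsGT (zero_lt_one' ℝ)))).exists
  have hexp : expMap (Metric.sphere 0 1) x (t • v) = Real.cos t • x + Real.sin t • v :=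
    expMap_eq hed (hgeo.isExpValue h00 hd0 (abs_lt.2 ⟨by linarith, h1⟩))
  have hz : x + t • v ≠ 0 := by
    intro h
    have h2 := norm_sq_add_smul hx hv hxv 1 t
    rw [one_smul, h, norm_zero] at h2
    nlinarith
  have hproj : projRetraction (Metric.sphere 0 1) x (t • v) = ‖x + t • v‖⁻¹ • (x + t • v) := by
    refine projRetraction_eq hpd ?_
    have h2 := mem_nearestPoints_sphere_smul (y := ‖x + t • v‖⁻¹ • (x + t • v))
      (norm_smul_inv_norm (𝕜 := ℝ) hz) (norm_nonneg (x + t • v))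
    rwa [smul_smul, mul_inv_cancel₀ (norm_ne_zero_iff.2 hz), one_smul] at h2
  rw [hexp, hproj, ENNReal.div_lt_iff (Or.inl (by simp [h0.ne'])) (Or.inl (by simp))] at ht
  have h2 := (enorm_sub_le_riemannianDist _ _ _).trans_lt ht
  rw [← enorm_pow, ← ofReal_norm, ← ofReal_norm, ← ENNReal.ofReal_mul (by norm_num),
    ENNReal.ofReal_lt_ofReal_iff_of_nonneg (norm_nonneg _),
    Real.norm_of_nonneg (by positivity : 0 ≤ t ^ 3)] at h2
  linarith [norm_greatCircle_sub_ge hx hv hxv h0 h1.le]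

end Sphere

end Submfd

theorem mainTheorem3 :
    (∀ (n c : ℕ) (k : WithTop ℕ∞), 3 ≤ k →
      ∀ M : Set (EuclideanSpace ℝ (Fin n)), Submfd.IsSubmanifold k c M →
        ∀ x ∈ M, ∀ v ∈ Submfd.tangentSpace M x,
          (∀ᶠ t : ℝ in 𝓝 0, (x, t • v) ∈ Submfd.projDomain M ∧ (x, t • v) ∈ Submfd.expDomain M) ∧
          Submfd.ProjAgreesWithExp M 2 x v) ∧
    (∀ k : WithTop ℕ∞, 4 ≤ k →
      Submfd.IsSubmanifold k 1 (Metric.sphere (0 : EuclideanSpace ℝ (Fin 2)) 1)) ∧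
    ¬ (∀ x ∈ Metric.sphere (0 : EuclideanSpace ℝ (Fin 2)) 1,
        ∀ v ∈ Submfd.tangentSpace (Metric.sphere (0 : EuclideanSpace ℝ (Fin 2)) 1) x,
          Submfd.ProjAgreesWithExp (Metric.sphere (0 : EuclideanSpace ℝ (Fin 2)) 1) 3 x v) := by
  refine ⟨fun n c k hk M hM x hx v hv => hM.projAgreesWithExp hk hx hv,
    fun k _ => Submfd.isSubmanifold_sphere k, fun h => ?_⟩
  obtain ⟨hv, hn⟩ := Submfd.not_projAgreesWithExp_three_sphere
    (x := EuclideanSpace.single (0 : Fin 2) (1 : ℝ)) (v := EuclideanSpace.single (1 : Fin 2) (1 : ℝ))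
    (by simp) (by simp) (by simp [EuclideanSpace.inner_single_left])
  exact hn (h _ (by simp) _ hv)
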